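/- **Theorem 5.1.** Let $n\ge 0$ and let $\lambda$ be a partition with $|\lambda|\le n$, with $\ell(\lambda)$ parts and largest part $\lambda_1$ ($\lambda_1=0$ if $\lambda$ is empty). For a partition $\mu$ let $$s_\mu(x_1,\dots,x_n)=\sum_{T}\ \prod_{(r,c)\in\mu}x_{T(r,c)}$$ be the Schur polynomial, the sum being over all semistandard Young tableaux $T$ of shape $\mu$ with entries in $\{1,\dots,n\}$, and put $$\overline{s}_\lambda(x_1,\dots,x_n)=s_\lambda\big((x_1+\dots+x_n)-x_1,\ \dots,\ (x_1+\dots+x_n)-x_n\big).$$ Then $\overline{s}_\lambda(x_1,\dots,x_n)$ has a unique expansion as an integer linear combination of the Schur polynomials $s_\mu(x_1,\dots,x_n)$ with $\ell(\mu)\le n$. For every integer $p$ with $\ell(\lambda)\le p\le n-\lambda_1$, the coefficient $[s_{(1^{|\lambda|})}]\,\overline{s}_\lambda(x_1,\dots,x_n)$ of $s_{(1^{|\lambda|})}$ in this expansion equals the number of fillings $T$ of the Young diagram of $\lambda$ with numbers in $\{2,\dots,n\}$ such that (with $T(r,c)$ the entry in row $r$ and column $c$, rows and columns numbered from $1$)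 1. whenever $(r,c)$ and $(r,c+1)$ are both boxes of $\lambda$: $T(r,c)\le T(r,c+1)$, and $T(r,c)$ and $T(r,c+1)$ are not both equal to $p-r+c+1$; 2. whenever $(r-1,c)$ and $(r,c)$ are both boxes of $\lambda$: either $T(r-1,c)<T(r,c)$, or $T(r-1,c)=T(r,c)=p-r+c+1$. -/

import Mathlib

open MvPolynomial

namespace ChernPlethysm

/-- Partitions are Young diagrams (`YoungDiagram`): `μ.colLen 0` is the number of parts,
`μ.rowLen 0` is the largest part and `μ.card` is the size. Cells `(i, j)` are numbered from `0`,
so `(i, j)` is the box in row `r = i + 1` and column `c = j + 1`.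

`BoundedSSYT μ n` is the set of semistandard Young tableaux of shape `μ` with entries in an
alphabet of `n` letters, namely `0, …, n - 1` (the letter `k` stands for the label `k + 1`). -/
abbrev BoundedSSYT (μ : YoungDiagram) (n : ℕ) : Type :=
  {T : SemistandardYoungTableau μ // ∀ i j : ℕ, (i, j) ∈ μ → T i j < n}

instance (μ : YoungDiagram) (n : ℕ) : Finite (BoundedSSYT μ n) := by
  refine Finite.of_injective
    (fun (T : BoundedSSYT μ n) (c : {c : ℕ × ℕ // c ∈ μ.cells}) =>
      (⟨T.1 c.1.1 c.1.2, T.2 _ _ c.2⟩ : Fin n)) ?_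
  intro T T' h
  apply Subtype.ext
  ext i j
  by_cases hc : (i, j) ∈ μ
  · exact congrArg Fin.val (congrFun h ⟨(i, j), hc⟩)
  · rw [T.1.zeros hc, T'.1.zeros hc]

noncomputable instance (μ : YoungDiagram) (n : ℕ) : Fintype (BoundedSSYT μ n) :=
  Fintype.ofFinite _

/-- The Schur polynomial `s_μ(x_1, …, x_n)`: the sum over semistandard tableaux of shape `μ` of the
product of the variables indexed by the entries. -/
noncomputable def schurPoly (n : ℕ) (μ : YoungDiagram) : MvPolynomial (Fin n) ℤ :=
  ∑ T : BoundedSSYT μ n, ∏ c ∈ μ.cells.attach, X ⟨T.1 c.1.1 c.1.2, T.2 _ _ c.2⟩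

/-- The polynomial `s̄_μ(x_1, …, x_n)`: the Schur polynomial `s_μ` evaluated at
`(x_1 + ⋯ + x_n) - x_1, …, (x_1 + ⋯ + x_n) - x_n`. -/
noncomputable def schurBar (n : ℕ) (μ : YoungDiagram) : MvPolynomial (Fin n) ℤ :=
  aeval (fun i : Fin n => (∑ j : Fin n, X j) - X i : Fin n → MvPolynomial (Fin n) ℤ)
    (schurPoly n μ)

/-- `a` is the coefficient function of a Schur expansion of the polynomial `f` in `n` variables:
`f = ∑ a_μ s_μ(x_1, …, x_n)`, a finite sum over partitions `μ` with at most `n` parts. -/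
def IsSchurExpansion (n : ℕ) (f : MvPolynomial (Fin n) ℤ) (a : YoungDiagram →₀ ℤ) : Prop :=
  (∀ μ ∈ a.support, μ.colLen 0 ≤ n) ∧ f = a.sum fun μ z => z • schurPoly n μ

/-- The partition `(1^m)`: a single column with `m` boxes. -/
def column (m : ℕ) : YoungDiagram :=
  YoungDiagram.ofRowLens (List.replicate m 1) (List.pairwise_replicate_of_refl.sortedGE)

/-- Fillings of the diagram `μ` with entries in `{2, …, n}` (extended by `0` outside `μ`), weakly
increasing along rows and strictly increasing down columns, except for equal neighbours with a
certain value: writing `T(r, c)` for the entry in row `r` and column `c`, both numbered from `1`,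
* `T(r, c) ≤ T(r, c + 1)`, and they are not both equal to `p - r + c + 1`;
* `T(r - 1, c) < T(r, c)`, or `T(r - 1, c) = T(r, c) = p - r + c + 1`.
In the fields below, `r = i + 1` in `row` and `r = i + 2` in `col`, and `c = j + 1` in both. -/
@[ext]
structure ColumnFilling (n p : ℕ) (μ : YoungDiagram) where
  entry : ℕ → ℕ → ℕ
  mem_Icc : ∀ i j : ℕ, (i, j) ∈ μ → entry i j ∈ Finset.Icc 2 n
  row : ∀ i j : ℕ, (i, j) ∈ μ → (i, j + 1) ∈ μ →
    entry i j ≤ entry i (j + 1) ∧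
      ¬ ((entry i j : ℤ) = (p : ℤ) - (i + 1) + (j + 1) + 1 ∧
        (entry i (j + 1) : ℤ) = (p : ℤ) - (i + 1) + (j + 1) + 1)
  col : ∀ i j : ℕ, (i, j) ∈ μ → (i + 1, j) ∈ μ →
    entry i j < entry (i + 1) j ∨
      ((entry i j : ℤ) = (p : ℤ) - (i + 2) + (j + 1) + 1 ∧
        (entry (i + 1) j : ℤ) = (p : ℤ) - (i + 2) + (j + 1) + 1)
  zeros : ∀ i j : ℕ, (i, j) ∉ μ → entry i j = 0

instance (n p : ℕ) (μ : YoungDiagram) : Finite (ColumnFilling n p μ) := by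
  refine Finite.of_injective
    (fun (T : ColumnFilling n p μ) (c : {c : ℕ × ℕ // c ∈ μ.cells}) =>
      (⟨T.entry c.1.1 c.1.2, T.mem_Icc _ _ c.2⟩ : {k : ℕ // k ∈ Finset.Icc 2 n})) ?_
  intro T T' h
  ext i j
  by_cases hc : (i, j) ∈ μ
  · exact congrArg Subtype.val (congrFun h ⟨(i, j), hc⟩)
  · rw [T.zeros i j hc, T'.zeros i j hc]

end ChernPlethysm

namespace ChernPlethysm

/-- Fillings of `μ` with the letters `0, …, m - 1`, weakly increasing along rows and strictly
increasing down columns, except that the letter `v` is special at the content `d v`: two equal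
neighbours `v` in a row may not meet there, whereas two equal neighbours `v` in a column may. -/
@[ext]
structure TwistedTableau (d : ℕ → ℤ) (m : ℕ) (μ : YoungDiagram) where
  entry : ℕ → ℕ → ℕ
  lt : ∀ i j : ℕ, (i, j) ∈ μ → entry i j < m
  row : ∀ i j : ℕ, (i, j + 1) ∈ μ → entry i j ≤ entry i (j + 1) ∧
    ¬ (entry i j = entry i (j + 1) ∧ d (entry i j) = j - i)
  col : ∀ i j : ℕ, (i + 1, j) ∈ μ → entry i j < entry (i + 1) j ∨
    (entry i j = entry (i + 1) j ∧ d (entry i j) = j - (i + 1))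
  zeros : ∀ i j : ℕ, (i, j) ∉ μ → entry i j = 0

namespace TwistedTableau

variable {d : ℕ → ℤ} {m : ℕ} {μ ν : YoungDiagram}

instance : Finite (TwistedTableau d m μ) := by
  refine Finite.of_injective
    (fun (T : TwistedTableau d m μ) (c : {c : ℕ × ℕ // c ∈ μ.cells}) =>
      (⟨T.entry c.1.1 c.1.2, T.lt _ _ c.2⟩ : Fin m)) ?_
  intro T T' h
  ext i j
  by_cases hc : (i, j) ∈ μ
  · exact congrArg Fin.val (congrFun h ⟨(i, j), hc⟩)
  · rw [T.zeros i j hc, T'.zeros i j hc]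

noncomputable instance : Fintype (TwistedTableau d m μ) := Fintype.ofFinite _

lemma row_le (T : TwistedTableau d m μ) {i j j' : ℕ} (h : j ≤ j') (hc : (i, j') ∈ μ) :
    T.entry i j ≤ T.entry i j' := by
  induction j', h using Nat.le_induction with
  | base => exact le_rfl
  | succ k hk ih =>
    exact (ih (μ.up_left_mem le_rfl k.le_succ hc)).trans (T.row i k hc).1

lemma col_le (T : TwistedTableau d m μ) {i i' j : ℕ} (h : i ≤ i') (hc : (i', j) ∈ μ) :
    T.entry i j ≤ T.entry i' j := by
  induction i', h using Nat.le_induction with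
  | base => exact le_rfl
  | succ k hk ih =>
    refine (ih (μ.up_left_mem k.le_succ le_rfl hc)).trans ?_
    rcases T.col k j hc with h | h
    · exact h.le
    · exact h.1.le

lemma entry_le (T : TwistedTableau d m μ) {i i' j j' : ℕ} (hi : i ≤ i') (hj : j ≤ j')
    (hc : (i', j') ∈ μ) : T.entry i j ≤ T.entry i' j' :=
  (T.row_le hj (μ.up_left_mem hi le_rfl hc)).trans (T.col_le hi hc)

/-- The product of the weights `z v` of the entries `v` of a filling. -/
def weight {R : Type*} [CommRing R] (z : ℕ → R) (T : TwistedTableau d m μ) : R :=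
  ∏ c ∈ μ.cells, z (T.entry c.1 c.2)

end TwistedTableau

/-- The boxes of `μ` outside `ν` may carry one letter that is special at the content `D`. -/
structure IsTwistedStrip (D : ℤ) (ν μ : YoungDiagram) : Prop where
  le : ν ≤ μ
  row : ∀ i j : ℕ, (i, j) ∉ ν → (i, j + 1) ∈ μ → D ≠ j - i
  col : ∀ i j : ℕ, (i, j) ∉ ν → (i + 1, j) ∈ μ → D = j - (i + 1)

instance (D : ℤ) (μ : YoungDiagram) : Finite {ν : YoungDiagram // IsTwistedStrip D ν μ} := by
  refine Finite.of_injective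
    (fun ν : {ν : YoungDiagram // IsTwistedStrip D ν μ} =>
      (⟨ν.1.cells, Finset.mem_powerset.2 (YoungDiagram.cells_subset_iff.2 ν.2.le)⟩ :
        {s // s ∈ μ.cells.powerset})) ?_
  intro ν ν' h
  exact Subtype.ext (YoungDiagram.ext (congrArg Subtype.val h))

noncomputable instance (D : ℤ) (μ : YoungDiagram) :
    Fintype {ν : YoungDiagram // IsTwistedStrip D ν μ} := Fintype.ofFinite _

namespace TwistedTableau

variable {d : ℕ → ℤ} {m : ℕ} {μ ν : YoungDiagram}

/-- Fill the boxes of `μ` outside `ν` with the letter `m`. -/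
def extend (h : IsTwistedStrip (d m) ν μ) (T : TwistedTableau d m ν) :
    TwistedTableau d (m + 1) μ where
  entry i j := if (i, j) ∈ ν then T.entry i j else if (i, j) ∈ μ then m else 0
  lt i j _ := by
    split_ifs with h1
    · exact (T.lt i j h1).trans m.lt_succ_self
    · exact m.lt_succ_self
  row i j hc := by
    have hc' : (i, j) ∈ μ := μ.up_left_mem le_rfl j.le_succ hc
    by_cases h2 : (i, j + 1) ∈ ν
    · have h1 : (i, j) ∈ ν := ν.up_left_mem le_rfl j.le_succ h2
      simpa only [h1, h2, if_true] using T.row i j h2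
    · by_cases h1 : (i, j) ∈ ν
      · have := T.lt i j h1
        simp only [h1, h2, hc, if_true, if_false]
        exact ⟨this.le, fun h => this.ne h.1⟩
      · simp only [h1, h2, hc, hc', if_true, if_false]
        exact ⟨le_rfl, fun h' => h.row i j h1 hc h'.2⟩
  col i j hc := by
    have hc' : (i, j) ∈ μ := μ.up_left_mem i.le_succ le_rfl hc
    by_cases h2 : (i + 1, j) ∈ ν
    · have h1 : (i, j) ∈ ν := ν.up_left_mem i.le_succ le_rfl h2
      simpa only [h1, h2, if_true] using T.col i j h2
    · by_cases h1 : (i, j) ∈ ν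
      · simp only [h1, h2, hc, if_true, if_false]
        exact Or.inl (T.lt i j h1)
      · simp only [h1, h2, hc, hc', if_true, if_false]
        exact Or.inr ⟨trivial, h.col i j h1 hc⟩
  zeros i j hc := by
    rw [if_neg fun h' => hc (h.le h'), if_neg hc]

lemma mem_iff_extend_lt (h : IsTwistedStrip (d m) ν μ) (T : TwistedTableau d m ν) (i j : ℕ) :
    (i, j) ∈ ν ↔ (i, j) ∈ μ ∧ (extend h T).entry i j < m := by
  simp only [extend]
  constructor
  · intro h1
    simpa only [h1, if_true] using ⟨h.le h1, T.lt i j h1⟩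
  · rintro ⟨h1, h2⟩
    by_contra h3
    simp [h3, h1] at h2

lemma weight_extend {R : Type*} [CommRing R] (z : ℕ → R) (h : IsTwistedStrip (d m) ν μ)
    (T : TwistedTableau d m ν) :
    (extend h T).weight z = z m ^ (μ.card - ν.card) * T.weight z := by
  have hsub : ν.cells ⊆ μ.cells := YoungDiagram.cells_subset_iff.2 h.le
  rw [weight, weight, ← Finset.prod_sdiff hsub]
  congr 1
  · rw [YoungDiagram.card, YoungDiagram.card, ← Finset.card_sdiff_of_subset hsub]
    refine Finset.prod_eq_pow_card fun c hc => ?_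
    rw [Finset.mem_sdiff] at hc
    have h1 : (c.1, c.2) ∈ μ := hc.1
    have h2 : (c.1, c.2) ∉ ν := hc.2
    simp only [extend, h1, h2, if_true, if_false]
  · refine Finset.prod_congr rfl fun c hc => ?_
    have h2 : (c.1, c.2) ∈ ν := hc
    simp only [extend, h2, if_true]

lemma extend_bijective (d : ℕ → ℤ) (m : ℕ) (μ : YoungDiagram) :
    Function.Bijective (fun x : Σ ν : {ν : YoungDiagram // IsTwistedStrip (d m) ν μ},
      TwistedTableau d m ν.1 => extend x.1.2 x.2) := by
  constructor
  · rintro ⟨⟨ν, hν⟩, T⟩ ⟨⟨ν', hν'⟩, T'⟩ h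
    simp only at h
    obtain rfl : ν = ν' := by
      ext ⟨i, j⟩
      rw [YoungDiagram.mem_cells, YoungDiagram.mem_cells, mem_iff_extend_lt hν T,
        mem_iff_extend_lt hν' T', h]
    congr 1
    ext i j
    by_cases hc : (i, j) ∈ ν
    · have := congrArg (fun S => S.entry i j) h
      simpa only [extend, hc, if_true] using this
    · rw [T.zeros i j hc, T'.zeros i j hc]
  · intro T
    let ν : YoungDiagram :=
      { cells := μ.cells.filter fun c => T.entry c.1 c.2 < m
        isLowerSet := by
          rintro ⟨i', j'⟩ ⟨i, j⟩ hle hc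
          simp only [Finset.coe_filter, Set.mem_ofPred_eq] at hc ⊢
          exact ⟨μ.up_left_mem hle.1 hle.2 hc.1, (T.entry_le hle.1 hle.2 hc.1).trans_lt hc.2⟩ }
    have hmem : ∀ i j, (i, j) ∈ ν ↔ (i, j) ∈ μ ∧ T.entry i j < m := fun i j => by
      rw [← YoungDiagram.mem_cells, Finset.mem_filter]; rfl
    have heq : ∀ i j, (i, j) ∈ μ → (i, j) ∉ ν → T.entry i j = m := fun i j hc hn => by
      have h1 := T.lt i j hc
      have h2 : ¬ T.entry i j < m := fun h => hn ((hmem i j).2 ⟨hc, h⟩)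
      omega
    have hν : IsTwistedStrip (d m) ν μ := by
      refine ⟨fun c hc => ((hmem c.1 c.2).1 hc).1, fun i j hn hc h => ?_, fun i j hn hc => ?_⟩
      · have hc' : (i, j) ∈ μ := μ.up_left_mem le_rfl j.le_succ hc
        have h2 := heq i (j + 1) hc fun h => hn (ν.up_left_mem le_rfl j.le_succ h)
        have h1 := heq i j hc' hn
        exact (T.row i j hc).2 ⟨h1.trans h2.symm, by rw [h1, h]⟩
      · have hc' : (i, j) ∈ μ := μ.up_left_mem i.le_succ le_rfl hc
        have h2 := heq (i + 1) j hc fun h => hn (ν.up_left_mem i.le_succ le_rfl h)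
        have h1 := heq i j hc' hn
        rcases T.col i j hc with h | h
        · omega
        · rw [← h.2, h1]
    refine ⟨⟨⟨ν, hν⟩, ⟨fun i j => if (i, j) ∈ ν then T.entry i j else 0, fun i j hc => ?_,
      fun i j hc => ?_, fun i j hc => ?_, fun i j hc => if_neg hc⟩⟩, ?_⟩
    · rw [if_pos hc]; exact ((hmem i j).1 hc).2
    · rw [if_pos hc, if_pos (ν.up_left_mem le_rfl j.le_succ hc)]
      exact T.row i j ((hmem _ _).1 hc).1
    · rw [if_pos hc, if_pos (ν.up_left_mem i.le_succ le_rfl hc)]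
      exact T.col i j ((hmem _ _).1 hc).1
    · ext i j
      simp only [extend]
      split_ifs with h1 h2
      · rfl
      · exact (heq i j h2 h1).symm
      · exact (T.zeros i j h2).symm

lemma sum_weight_succ {R : Type*} [CommRing R] (z : ℕ → R) (d : ℕ → ℤ) (m : ℕ)
    (μ : YoungDiagram) :
    ∑ T : TwistedTableau d (m + 1) μ, T.weight z =
      ∑ ν : {ν : YoungDiagram // IsTwistedStrip (d m) ν μ},
        z m ^ (μ.card - ν.1.card) * ∑ T : TwistedTableau d m ν.1, T.weight z := by
  rw [← (extend_bijective d m μ).sum_comp (fun T => T.weight z), Fintype.sum_sigma]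
  refine Fintype.sum_congr _ _ fun ν => ?_
  rw [Finset.mul_sum]
  exact Fintype.sum_congr _ _ fun T => weight_extend z ν.2 T

end TwistedTableau


/-- The weighted number of lattice paths from column `j` to column `x` that use the heights
`0, …, m - 1`, an east step at height `v` having weight `z v`, and that never pass straight
through column `D v` at height `v`. -/
def pathSum {R : Type*} [CommRing R] (z : ℕ → R) (D : ℕ → ℤ) : ℕ → ℕ → ℕ → R
  | 0, x, j => if x = j then 1 else 0
  | m + 1, x, j => ∑ y ∈ Finset.range (x + 1) with (D m < (x : ℕ) → D m ≤ (y : ℕ)),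
      z m ^ (x - y) * pathSum z D m y j

/-- Where the `k`-th of `l` paths may enter a height with special column `D` if they
leave it at the columns `X`. -/
def entryInterval {l : ℕ} (D : ℤ) (X : Fin l → ℕ) (k : Fin l) : Finset ℕ :=
  (Finset.range (X k + 1)).filter fun y => (D < X k → D ≤ y) ∧
    ∀ k' : Fin l, (k' : ℕ) + 1 = k → X k' < y ∨ (X k' = y ∧ (y : ℤ) = D)

lemma mem_entryInterval {l : ℕ} {D : ℤ} {X : Fin l → ℕ} {k : Fin l} {y : ℕ} :
    y ∈ entryInterval D X k ↔ y ≤ X k ∧ (D < X k → D ≤ y) ∧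
      ∀ k' : Fin l, (k' : ℕ) + 1 = k → X k' < y ∨ (X k' = y ∧ (y : ℤ) = D) := by
  rw [entryInterval, Finset.mem_filter, Finset.mem_range, Nat.lt_succ_iff]

section

variable {R : Type*} [CommRing R]

lemma det_sum_path_step {n : ℕ} (w : R) (D : ℤ) (g : ℕ → Fin (n + 1) → R)
    (X : Fin (n + 1) → ℕ) (hX : StrictMono X) :
    Matrix.det (Matrix.of fun k j => ∑ y ∈ Finset.range (X k + 1) with (D < (X k : ℕ) → D ≤ (y : ℕ)),
        w ^ (X k - y) * g y j) =
      Matrix.det (Matrix.of fun k j => ∑ y ∈ entryInterval D X k, w ^ (X k - y) * g y j) := by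
  refine Matrix.det_eq_of_forall_row_eq_smul_add_pred
    (fun i => if ((X i.succ : ℤ) ≤ D ∨ D < X i.castSucc) then w ^ (X i.succ - X i.castSucc) else 0)
    (fun j => ?_) (fun i j => ?_)
  · simp only [Matrix.of_apply]
    refine Finset.sum_congr ?_ fun _ _ => rfl
    ext y
    simp [entryInterval]
  · have hlt : X i.castSucc < X i.succ := hX Fin.castSucc_lt_succ
    have hI : ∀ y, y ∈ entryInterval D X i.succ ↔ y ≤ X i.succ ∧ (D < X i.succ → D ≤ y) ∧
        (X i.castSucc < y ∨ (X i.castSucc = y ∧ (y : ℤ) = D)) := by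
      intro y
      rw [mem_entryInterval]
      refine and_congr_right fun _ => and_congr_right fun _ => ⟨fun h => h _ (by simp), ?_⟩
      intro h k' hk'
      obtain rfl : k' = i.castSucc := by
        ext; simpa using hk'
      exact h
    simp only [Matrix.of_apply]
    split_ifs with hc
    · rw [Finset.mul_sum]
      rw [← Finset.sum_sdiff (s₁ := (Finset.range (X i.castSucc + 1)).filter fun y : ℕ =>
        (D < (X i.castSucc : ℕ) → D ≤ (y : ℕ)))]
      · congr 1
        · refine Finset.sum_congr ?_ fun _ _ => rfl
          ext y
          rw [hI]
          simp only [Finset.mem_sdiff, Finset.mem_filter, Finset.mem_range]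
          omega
        · refine Finset.sum_congr rfl fun y hy => ?_
          simp only [Finset.mem_filter, Finset.mem_range] at hy
          rw [← mul_assoc, ← pow_add]
          congr 2
          omega
      · intro y
        simp only [Finset.mem_filter, Finset.mem_range]
        omega
    · rw [zero_mul, add_zero]
      refine Finset.sum_congr ?_ fun _ _ => rfl
      ext y
      rw [hI]
      simp only [Finset.mem_filter, Finset.mem_range]
      omega

lemma det_pathSum_succ {l : ℕ} (z : ℕ → R) (D : ℕ → ℤ) (m : ℕ) (X : Fin l → ℕ)
    (hX : StrictMono X) :
    Matrix.det (Matrix.of fun k j : Fin l => pathSum z D (m + 1) (X k) j) =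
      ∑ Y ∈ Fintype.piFinset (entryInterval (D m) X), (∏ k, z m ^ (X k - Y k)) *
        Matrix.det (Matrix.of fun k j : Fin l => pathSum z D m (Y k) j) := by
  rcases l with _ | n
  · simp
  refine (det_sum_path_step (z m) (D m) (fun y j => pathSum z D m y j) X hX).trans ?_
  have h := (Matrix.detRowAlternating (n := Fin (n + 1)) (R := R)).toMultilinearMap.map_sum_finset
    (fun k y => fun j : Fin (n + 1) => z m ^ (X k - y) * pathSum z D m y j)
    (entryInterval (D m) X)
  have h2 : (fun k => ∑ y ∈ entryInterval (D m) X k,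
      (fun j : Fin (n + 1) => z m ^ (X k - y) * pathSum z D m y j)) =
      fun k (j : Fin (n + 1)) => ∑ y ∈ entryInterval (D m) X k, z m ^ (X k - y) * pathSum z D m y j := by
    ext k j
    rw [Finset.sum_apply]
  rw [h2] at h
  refine h.trans (Finset.sum_congr rfl fun Y _ => ?_)
  exact Matrix.det_mul_column (fun k => z m ^ (X k - Y k))
    (Matrix.of fun k j : Fin (n + 1) => pathSum z D m (Y k) j)

end

/-- The column in which the `k`-th of `l` paths ends, for the row of `μ` with index `l - 1 - k`. -/
def endColumn (l : ℕ) (μ : YoungDiagram) (k : Fin l) : ℕ := μ.rowLen k.rev + k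

lemma endColumn_strictMono (l : ℕ) (μ : YoungDiagram) : StrictMono (endColumn l μ) := by
  intro k k' h
  have h1 : (k : ℕ) < k' := h
  have := μ.rowLen_anti k'.rev k.rev (by simp only [Fin.val_rev]; omega)
  simp only [endColumn]
  omega

lemma rowLen_eq_zero {μ : YoungDiagram} {i : ℕ} (h : μ.colLen 0 ≤ i) : μ.rowLen i = 0 := by
  by_contra h0
  have : (i, 0) ∈ μ := YoungDiagram.mem_iff_lt_rowLen.2 (Nat.pos_of_ne_zero h0)
  rw [YoungDiagram.mem_iff_lt_colLen] at this
  omega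

lemma card_eq_sum_rowLen {μ : YoungDiagram} {l : ℕ} (h : μ.colLen 0 ≤ l) :
    μ.card = ∑ k : Fin l, μ.rowLen k.rev := by
  have h1 : ∀ c ∈ μ.cells, c.1 ∈ Finset.range l := fun c hc => by
    have : (c.1, 0) ∈ μ := μ.up_left_mem le_rfl (Nat.zero_le c.2) hc
    rw [YoungDiagram.mem_iff_lt_colLen] at this
    exact Finset.mem_range.2 (this.trans_le h)
  rw [YoungDiagram.card, Finset.card_eq_sum_card_fiberwise h1]
  refine Eq.trans ?_ (Equiv.sum_comp Fin.revPerm fun k : Fin l => μ.rowLen k).symm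
  rw [Finset.sum_range]
  refine Finset.sum_congr rfl fun i _ => ?_
  rw [YoungDiagram.rowLen_eq_card]
  rfl

lemma colLen_le_of_le {ν μ : YoungDiagram} (h : ν ≤ μ) (j : ℕ) : ν.colLen j ≤ μ.colLen j := by
  by_contra hlt
  have : (μ.colLen j, j) ∈ ν := YoungDiagram.mem_iff_lt_colLen.2 (not_le.1 hlt)
  exact lt_irrefl _ (YoungDiagram.mem_iff_lt_colLen.1 (h this))

lemma rowLen_le_of_le {ν μ : YoungDiagram} (h : ν ≤ μ) (i : ℕ) : ν.rowLen i ≤ μ.rowLen i := by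
  by_contra hlt
  have : (i, μ.rowLen i) ∈ ν := YoungDiagram.mem_iff_lt_rowLen.2 (not_le.1 hlt)
  exact lt_irrefl _ (YoungDiagram.mem_iff_lt_rowLen.1 (h this))

/-- The Young diagram with row lengths `f 0, …, f (l - 1)`. -/
def diagramOfRows (l : ℕ) (f : ℕ → ℕ) (hf : ∀ i i', i ≤ i' → i' < l → f i' ≤ f i) :
    YoungDiagram where
  cells := (Finset.range l ×ˢ Finset.range (f 0)).filter fun c => c.2 < f c.1
  isLowerSet := by
    rintro ⟨i', j'⟩ ⟨i, j⟩ ⟨hi, hj⟩ hc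
    simp only [Finset.coe_filter, Finset.mem_product, Finset.mem_range, Set.mem_ofPred_eq]
      at hc hi hj ⊢
    have h1 := hf i i' hi (by omega)
    have h2 := hf 0 i (by omega) (by omega)
    omega

lemma mem_diagramOfRows {l : ℕ} {f : ℕ → ℕ} {hf} {i j : ℕ} :
    (i, j) ∈ diagramOfRows l f hf ↔ i < l ∧ j < f i := by
  rw [← YoungDiagram.mem_cells]
  simp only [diagramOfRows, Finset.mem_filter, Finset.mem_product, Finset.mem_range]
  constructor
  · omega
  · intro h
    have := hf 0 i (by omega) (by omega)
    omega

lemma rowLen_diagramOfRows {l : ℕ} {f : ℕ → ℕ} {hf} {i : ℕ} (h : i < l) :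
    (diagramOfRows l f hf).rowLen i = f i := by
  refine le_antisymm ?_ ?_ <;> by_contra hlt <;> rw [not_le] at hlt
  · rw [← YoungDiagram.mem_iff_lt_rowLen, mem_diagramOfRows] at hlt
    omega
  · have := (mem_diagramOfRows (hf := hf)).2 ⟨h, hlt⟩
    exact lt_irrefl _ (YoungDiagram.mem_iff_lt_rowLen.1 this)

lemma colLen_diagramOfRows_le {l : ℕ} {f : ℕ → ℕ} {hf} :
    (diagramOfRows l f hf).colLen 0 ≤ l := by
  by_contra hlt
  rw [not_le, ← YoungDiagram.mem_iff_lt_colLen, mem_diagramOfRows] at hlt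
  omega

lemma diagram_ext_rowLen {μ ν : YoungDiagram} (h : ∀ i, μ.rowLen i = ν.rowLen i) : μ = ν := by
  ext ⟨i, j⟩
  rw [YoungDiagram.mem_cells, YoungDiagram.mem_cells, YoungDiagram.mem_iff_lt_rowLen,
    YoungDiagram.mem_iff_lt_rowLen, h]


lemma IsTwistedStrip.endColumn_mem {D : ℤ} {ν μ : YoungDiagram} (h : IsTwistedStrip D ν μ)
    (l : ℕ) :
    endColumn l ν ∈ Fintype.piFinset (entryInterval (D + l) (endColumn l μ)) := by
  rw [Fintype.mem_piFinset]
  intro k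
  have hk := k.2
  have hle := rowLen_le_of_le h.le k.rev
  simp only [mem_entryInterval, endColumn]
  refine ⟨by omega, fun hlt => ?_, fun k' hk' => ?_⟩
  · by_contra hn
    have hrev : (k.rev : ℕ) = l - (k + 1) := Fin.val_rev k
    obtain ⟨j, hj⟩ : ∃ j : ℕ, (j : ℤ) = D + k.rev := ⟨(D + k.rev).toNat, by omega⟩
    refine h.row k.rev j ?_ ?_ (by omega)
    · rw [YoungDiagram.mem_iff_lt_rowLen]; omega
    · rw [YoungDiagram.mem_iff_lt_rowLen]; omega
  · have hrev : (k.rev : ℕ) = l - (k + 1) := Fin.val_rev k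
    have hrev' : (k'.rev : ℕ) = k.rev + 1 := by rw [Fin.val_rev]; omega
    rw [hrev']
    have key : ∀ j : ℕ, ν.rowLen k.rev ≤ j → j < μ.rowLen (k.rev + 1) → D = j - (k.rev + 1) :=
      fun j h1 h2 => h.col k.rev j (by rw [YoungDiagram.mem_iff_lt_rowLen]; omega)
        (by rw [YoungDiagram.mem_iff_lt_rowLen]; omega)
    by_cases hlt : ν.rowLen k.rev < μ.rowLen (k.rev + 1)
    · have h1 := key (ν.rowLen k.rev) le_rfl hlt
      by_cases hlt2 : ν.rowLen k.rev + 1 < μ.rowLen (k.rev + 1)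
      · have h2 := key (ν.rowLen k.rev + 1) (by omega) hlt2
        omega
      · omega
    · omega

lemma isTwistedStrip_of_endColumn_mem {D : ℤ} {ν μ : YoungDiagram} {l : ℕ}
    (hμ : μ.colLen 0 ≤ l) (hν : ν.colLen 0 ≤ l)
    (h : endColumn l ν ∈ Fintype.piFinset (entryInterval (D + l) (endColumn l μ))) :
    IsTwistedStrip D ν μ := by
  rw [Fintype.mem_piFinset] at h
  simp only [mem_entryInterval, endColumn] at h
  have key : ∀ i (hi : i < l), ν.rowLen i ≤ μ.rowLen i ∧
      (D + l < μ.rowLen i + (l - (i + 1) : ℕ) → D + l ≤ ν.rowLen i + (l - (i + 1) : ℕ)) ∧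
      (i + 1 < l → μ.rowLen (i + 1) ≤ ν.rowLen i ∨
        (μ.rowLen (i + 1) = ν.rowLen i + 1 ∧ (ν.rowLen i + (l - (i + 1) : ℕ) : ℤ) = D + l)) := by
    intro i hi
    obtain ⟨h1, h2, h3⟩ := h (Fin.rev ⟨i, hi⟩)
    simp only [Fin.rev_rev, Fin.val_rev] at h1 h2 h3
    refine ⟨by omega, by push_cast at h2; exact h2, fun hi' => ?_⟩
    have := h3 (Fin.rev ⟨i + 1, hi'⟩) (by simp only [Fin.val_rev]; omega)
    rw [show l - ((Fin.rev ⟨i + 1, hi'⟩ : Fin l) + 1 : ℕ) = i + 1 by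
      simp only [Fin.val_rev]; omega] at this
    simp only [Fin.val_rev] at this
    push_cast at this
    omega
  have hle : ν ≤ μ := by
    rintro ⟨i, j⟩ hc
    have hc' : (i, j) ∈ ν := hc
    show (i, j) ∈ μ
    rw [YoungDiagram.mem_iff_lt_rowLen] at hc' ⊢
    by_cases hi : i < l
    · exact hc'.trans_le (key i hi).1
    · rw [rowLen_eq_zero (by omega)] at hc'
      omega
  refine ⟨hle, fun i j hn hc => ?_, fun i j hn hc => ?_⟩
  · rw [YoungDiagram.mem_iff_lt_rowLen] at hn hc
    have hi : i < l := by
      by_contra hi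
      rw [rowLen_eq_zero (by omega)] at hc
      omega
    have := key i hi
    omega
  · rw [YoungDiagram.mem_iff_lt_rowLen] at hn hc
    have hi : i + 1 < l := by
      by_contra hi
      rw [rowLen_eq_zero (by omega)] at hc
      omega
    have := key i (by omega)
    omega

lemma endColumn_injective {l : ℕ} {ν ν' : YoungDiagram} (h : ν.colLen 0 ≤ l)
    (h' : ν'.colLen 0 ≤ l) (heq : endColumn l ν = endColumn l ν') : ν = ν' := by
  refine diagram_ext_rowLen fun i => ?_
  by_cases hi : i < l
  · have := congrFun heq (Fin.rev ⟨i, hi⟩)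
    simpa [endColumn] using this
  · rw [rowLen_eq_zero (by omega), rowLen_eq_zero (by omega)]

lemma exists_endColumn_eq {l : ℕ} {Y : Fin l → ℕ} (hY : StrictMono Y) :
    ∃ ν : YoungDiagram, ν.colLen 0 ≤ l ∧ endColumn l ν = Y := by
  let f : ℕ → ℕ := fun i => if h : i < l then Y (Fin.rev ⟨i, h⟩) - (l - (i + 1)) else 0
  have hstep : ∀ a (ha : a < l) b (hb : b < l), a ≤ b → Y ⟨a, ha⟩ + (b - a) ≤ Y ⟨b, hb⟩ := by
    intro a ha b hb hab
    induction b, hab using Nat.le_induction with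
    | base => simp
    | succ b hab ih =>
      have h1 := ih (by omega)
      have h2 : Y ⟨b, by omega⟩ < Y ⟨b + 1, hb⟩ := hY (by simp [Fin.lt_def])
      omega
  have hge : ∀ a (ha : a < l), a ≤ Y ⟨a, ha⟩ := fun a ha => by
    have := hstep 0 (by omega) a ha (Nat.zero_le a)
    omega
  have hf : ∀ i i', i ≤ i' → i' < l → f i' ≤ f i := by
    intro i i' h h'
    have hi : i < l := by omega
    have := hstep (l - (i' + 1)) (by omega) (l - (i + 1)) (by omega) (by omega)
    simp only [f, h', hi, dif_pos, Fin.rev]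
    omega
  refine ⟨diagramOfRows l f hf, colLen_diagramOfRows_le, ?_⟩
  ext k
  have h1 := hge k k.2
  have h2 := Fin.val_rev k
  rw [endColumn, rowLen_diagramOfRows k.rev.2]
  simp only [f, k.rev.2, dif_pos, Fin.eta, Fin.rev_rev] at h1 ⊢
  omega

lemma pow_card_sub_card {R : Type*} [CommRing R] (w : R) {ν μ : YoungDiagram} {l : ℕ}
    (hle : ν ≤ μ) (hμ : μ.colLen 0 ≤ l) :
    w ^ (μ.card - ν.card) = ∏ k : Fin l, w ^ (endColumn l μ k - endColumn l ν k) := by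
  rw [Finset.prod_pow_eq_pow_sum, card_eq_sum_rowLen hμ,
    card_eq_sum_rowLen ((colLen_le_of_le hle 0).trans hμ),
    ← Finset.sum_tsub_distrib _ fun k _ => rowLen_le_of_le hle k.rev]
  congr 1
  refine Finset.sum_congr rfl fun k _ => ?_
  simp only [endColumn]
  omega

theorem TwistedTableau.sum_weight_eq_det {R : Type*} [CommRing R] (z : ℕ → R) (d : ℕ → ℤ)
    (m : ℕ) {l : ℕ} {μ : YoungDiagram} (hμ : μ.colLen 0 ≤ l) :
    ∑ T : TwistedTableau d m μ, T.weight z =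
      Matrix.det (Matrix.of fun k j : Fin l =>
        pathSum z (fun v => d v + l) m (endColumn l μ k) j) := by
  induction m generalizing μ with
  | zero =>
    by_cases h0 : ∀ c, c ∉ μ
    · have hrow : ∀ i, μ.rowLen i = 0 := fun i => by
        by_contra hi
        exact h0 (i, 0) (YoungDiagram.mem_iff_lt_rowLen.2 (Nat.pos_of_ne_zero hi))
      have hcells : μ.cells = ∅ := Finset.eq_empty_of_forall_notMem fun c hc => h0 c hc
      have hone : (Matrix.of fun k j : Fin l =>
          pathSum z (fun v => d v + l) 0 (endColumn l μ k) j) = 1 := by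
        ext k j
        simp [pathSum, endColumn, hrow, Matrix.one_apply, Fin.ext_iff]
      let T₀ : TwistedTableau d 0 μ := ⟨fun _ _ => 0, fun i j h => (h0 _ h).elim,
        fun i j h => (h0 _ h).elim, fun i j h => (h0 _ h).elim, fun _ _ _ => rfl⟩
      have hT : ∀ T : TwistedTableau d 0 μ, T = T₀ := fun T => by
        ext i j
        exact T.zeros i j (h0 _)
      rw [hone, Matrix.det_one, Fintype.sum_eq_single T₀ fun T h => (h (hT T)).elim]
      simp [TwistedTableau.weight, hcells]
    · push Not at h0
      obtain ⟨⟨i, j⟩, hc⟩ := h0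
      have hc0 : (0, 0) ∈ μ := μ.up_left_mem (Nat.zero_le i) (Nat.zero_le j) hc
      have hl : 0 < l := (YoungDiagram.mem_iff_lt_colLen.1 hc0).trans_le hμ
      have hr := YoungDiagram.mem_iff_lt_rowLen.1 hc0
      rw [Matrix.det_eq_zero_of_row_eq_zero (Fin.rev ⟨0, hl⟩)]
      · refine Finset.sum_eq_zero fun T _ => ?_
        exact absurd (T.lt i j hc) (Nat.not_lt_zero _)
      · intro j
        have := j.2
        refine if_neg ?_
        rw [endColumn, Fin.rev_rev, Fin.val_rev]
        simp only
        omega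
  | succ m ih =>
    rw [det_pathSum_succ _ _ _ _ (endColumn_strictMono l μ), TwistedTableau.sum_weight_succ]
    refine Finset.sum_of_injOn (fun ν => endColumn l ν.1) ?_ ?_ ?_ ?_
    · intro ν _ ν' _ heq
      exact Subtype.ext (endColumn_injective ((colLen_le_of_le ν.2.le 0).trans hμ)
        ((colLen_le_of_le ν'.2.le 0).trans hμ) heq)
    · intro ν _
      exact ν.2.endColumn_mem l
    · intro Y hY hnot
      have hmono : Monotone Y := by
        rcases l with _ | n
        · exact fun k => k.elim0
        refine Fin.monotone_iff_le_succ.2 fun k => ?_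
        have h1 := Fintype.mem_piFinset.1 hY k.castSucc
        have h2 := Fintype.mem_piFinset.1 hY k.succ
        simp only [mem_entryInterval] at h1 h2
        have h3 := h2.2.2 k.castSucc (by simp)
        omega
      have hninj : ¬ Function.Injective Y := by
        intro hinj
        obtain ⟨ν, hν, rfl⟩ := exists_endColumn_eq (hmono.strictMono_of_injective hinj)
        exact hnot ⟨⟨ν, isTwistedStrip_of_endColumn_mem hμ hν hY⟩, by simp, rfl⟩
      simp only [Function.Injective, not_forall] at hninj
      obtain ⟨k, k', heq, hne⟩ := hninj
      rw [Matrix.det_zero_of_row_eq hne, mul_zero]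
      ext j
      simp only [Matrix.of_apply, heq]
    · intro ν _
      rw [ih ((colLen_le_of_le ν.2.le 0).trans hμ), pow_card_sub_card _ ν.2.le hμ]


section

variable {R : Type*} [CommRing R]

lemma coeff_mul_mk_pow (P : PowerSeries R) (w : R) (x : ℕ) :
    PowerSeries.coeff x (P * PowerSeries.mk fun k => w ^ k) =
      ∑ y ∈ Finset.range (x + 1), w ^ (x - y) * PowerSeries.coeff y P := by
  rw [PowerSeries.coeff_mul, Finset.Nat.sum_antidiagonal_eq_sum_range_succ
    fun a b => PowerSeries.coeff a P * PowerSeries.coeff b (PowerSeries.mk fun k => w ^ k)]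
  refine Finset.sum_congr rfl fun y _ => ?_
  rw [PowerSeries.coeff_mk, mul_comm]

lemma pathSum_eq_coeff (z : ℕ → R) (D : ℕ → ℤ) (m j : ℕ) {x : ℕ} (h : ∀ v, (x : ℤ) ≤ D v) :
    pathSum z D m x j = PowerSeries.coeff x
      (PowerSeries.X ^ j * ∏ v ∈ Finset.range m, PowerSeries.mk fun k => z v ^ k) := by
  induction m generalizing x with
  | zero => simp [pathSum, PowerSeries.coeff_X_pow]
  | succ m ih =>
    rw [Finset.prod_range_succ, ← mul_assoc, coeff_mul_mk_pow, pathSum,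
      Finset.filter_true_of_mem fun y _ hlt => absurd (h m) (not_le.2 hlt)]
    refine Finset.sum_congr rfl fun y hy => ?_
    rw [ih fun v => le_trans ?_ (h v)]
    exact_mod_cast Nat.lt_succ_iff.1 (Finset.mem_range.1 hy)

/-- The generating series `∏ 1 / (1 - x_i t)` of the complete symmetric polynomials. -/
noncomputable def completeSeries {n : ℕ} (x : Fin n → R) : PowerSeries R :=
  ∏ i, PowerSeries.mk fun k => x i ^ k

lemma completeSeries_mul_prod {n : ℕ} (x : Fin n → R) :
    completeSeries x * ∏ i, (1 - PowerSeries.C (x i) * PowerSeries.X) = 1 := by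
  rw [completeSeries, ← Finset.prod_mul_distrib]
  refine Finset.prod_eq_one fun i _ => ?_
  ext k
  rw [mul_sub, mul_one, ← mul_assoc, map_sub]
  rcases k with _ | k
  · simp
  · rw [PowerSeries.coeff_succ_mul_X, PowerSeries.coeff_mul_C, PowerSeries.coeff_mk,
      PowerSeries.coeff_mk, PowerSeries.coeff_one, if_neg k.succ_ne_zero, pow_succ, sub_self]

end

/-- A special content beyond the diagram imposes nothing. -/
def BoundedSSYT.toTwisted {μ : YoungDiagram} {n : ℕ} (T : BoundedSSYT μ n) :
    TwistedTableau (fun _ => (μ.rowLen 0 : ℤ)) n μ where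
  entry := T.1
  lt := T.2
  row i j hc := by
    refine ⟨T.1.row_weak j.lt_succ_self hc, fun h => ?_⟩
    have h1 := μ.rowLen_anti 0 i (Nat.zero_le i)
    rw [YoungDiagram.mem_iff_lt_rowLen] at hc
    omega
  col i j hc := Or.inl (T.1.col_strict i.lt_succ_self hc)
  zeros i j hc := T.1.zeros hc

lemma BoundedSSYT.toTwisted_bijective (μ : YoungDiagram) (n : ℕ) :
    Function.Bijective (BoundedSSYT.toTwisted : BoundedSSYT μ n → _) := by
  constructor
  · intro T T' h
    apply Subtype.ext
    ext i j
    exact congrArg (fun S => S.entry i j) h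
  · intro T
    have hcol : ∀ {i j : ℕ}, (i + 1, j) ∈ μ → T.entry i j < T.entry (i + 1) j := by
      intro i j hc
      refine (T.col i j hc).resolve_right fun h => ?_
      have h1 := μ.rowLen_anti 0 (i + 1) (Nat.zero_le _)
      rw [YoungDiagram.mem_iff_lt_rowLen] at hc
      omega
    refine ⟨⟨⟨T.entry, fun h hc => T.row_le h.le hc, ?_, fun hc => T.zeros _ _ hc⟩, T.lt⟩, rfl⟩
    intro i i' j h hc
    exact (hcol (μ.up_left_mem h le_rfl hc)).trans_le (T.col_le h hc)

theorem aeval_schurPoly {A : Type*} [CommRing A] [Algebra ℤ A] {n : ℕ} (x : Fin n → A)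
    {l : ℕ} {μ : YoungDiagram} (hμ : μ.colLen 0 ≤ l) :
    aeval x (schurPoly n μ) = Matrix.det (Matrix.of fun k j : Fin l =>
      PowerSeries.coeff (endColumn l μ k) (PowerSeries.X ^ (j : ℕ) * completeSeries x)) := by
  let z : ℕ → A := fun v => if h : v < n then x ⟨v, h⟩ else 0
  have hz : ∀ i : Fin n, z i = x i := fun i => by simp [z]
  have h1 := TwistedTableau.sum_weight_eq_det z (fun _ => (μ.rowLen 0 : ℤ)) n hμ
  have h2 : completeSeries x = ∏ v ∈ Finset.range n, PowerSeries.mk fun k => z v ^ k := by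
    rw [Finset.prod_range, completeSeries]
    exact Finset.prod_congr rfl fun i _ => by rw [hz]
  rw [schurPoly, map_sum, h2]
  refine Eq.trans ?_ (h1.trans ?_)
  · rw [← (BoundedSSYT.toTwisted_bijective μ n).sum_comp]
    refine Fintype.sum_congr _ _ fun T => ?_
    rw [map_prod, TwistedTableau.weight, ← Finset.prod_attach μ.cells]
    refine Finset.prod_congr rfl fun c _ => ?_
    rw [aeval_X, ← hz]
    rfl
  · congr 1
    ext k j
    refine pathSum_eq_coeff _ _ _ _ fun _ => ?_
    have h3 := μ.rowLen_anti 0 k.rev (Nat.zero_le _)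
    have h4 := k.2
    rw [endColumn]
    push_cast
    omega

lemma completeSeries_comp_perm {A : Type*} [CommRing A] {n : ℕ} (x : Fin n → A)
    (σ : Equiv.Perm (Fin n)) : completeSeries (x ∘ σ) = completeSeries x :=
  Equiv.prod_comp σ fun i => PowerSeries.mk fun k => x i ^ k

lemma aeval_comp_perm_schurPoly {A : Type*} [CommRing A] [Algebra ℤ A] {n : ℕ} (x : Fin n → A)
    (σ : Equiv.Perm (Fin n)) (μ : YoungDiagram) :
    aeval (x ∘ σ) (schurPoly n μ) = aeval x (schurPoly n μ) := by
  rw [aeval_schurPoly _ le_rfl, aeval_schurPoly _ le_rfl, completeSeries_comp_perm]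

lemma schurPoly_isSymmetric (n : ℕ) (μ : YoungDiagram) : (schurPoly n μ).IsSymmetric := by
  intro σ
  have h := aeval_comp_perm_schurPoly (X : Fin n → MvPolynomial (Fin n) ℤ) σ μ
  rwa [← aeval_rename, aeval_X_left_apply, aeval_X_left_apply] at h

lemma schurBar_isSymmetric (n : ℕ) (μ : YoungDiagram) : (schurBar n μ).IsSymmetric := by
  intro σ
  rw [schurBar, comp_aeval_apply _ (rename σ)]
  refine Eq.trans ?_ (aeval_comp_perm_schurPoly _ σ μ)
  congr 2
  ext1 i
  simp only [Function.comp_apply, map_sub, map_sum, rename_X]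
  rw [Equiv.sum_comp σ fun j => (X j : MvPolynomial (Fin n) ℤ)]


/-- The exponent of the monomial of a tableau. -/
noncomputable def BoundedSSYT.content {μ : YoungDiagram} {n : ℕ} (T : BoundedSSYT μ n) :
    Fin n →₀ ℕ :=
  ∑ c ∈ μ.cells.attach, Finsupp.single ⟨T.1 c.1.1 c.1.2, T.2 _ _ c.2⟩ 1

lemma BoundedSSYT.content_apply {μ : YoungDiagram} {n : ℕ} (T : BoundedSSYT μ n) (v : Fin n) :
    T.content v = (μ.cells.filter fun c => T.1 c.1 c.2 = v).card := by
  rw [content, Finsupp.finsetSum_apply, Finset.card_filter, ← Finset.sum_attach μ.cells]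
  refine Finset.sum_congr rfl fun c _ => ?_
  rw [Finsupp.single_apply]
  simp only [Fin.ext_iff]

lemma schurPoly_eq_sum_monomial (n : ℕ) (μ : YoungDiagram) :
    schurPoly n μ = ∑ T : BoundedSSYT μ n, monomial T.content 1 := by
  refine Fintype.sum_congr _ _ fun T => ?_
  rw [BoundedSSYT.content, monomial_sum_one]
  rfl

lemma coeff_schurPoly (n : ℕ) (μ : YoungDiagram) (e : Fin n →₀ ℕ) :
    coeff e (schurPoly n μ) =
      ((Finset.univ.filter fun T : BoundedSSYT μ n => T.content = e).card : ℤ) := by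
  classical
  rw [schurPoly_eq_sum_monomial, coeff_sum]
  simp only [coeff_monomial]
  rw [Finset.sum_boole]

/-- The row lengths of `μ`, as an exponent in `n` variables. -/
noncomputable def rowExponent (n : ℕ) (μ : YoungDiagram) : Fin n →₀ ℕ :=
  Finsupp.equivFunOnFinite.symm fun i => μ.rowLen i

@[simp]
lemma rowExponent_apply (n : ℕ) (μ : YoungDiagram) (i : Fin n) :
    rowExponent n μ i = μ.rowLen i := rfl

lemma rowExponent_injOn {n : ℕ} {μ ν : YoungDiagram} (hμ : μ.colLen 0 ≤ n) (hν : ν.colLen 0 ≤ n)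
    (h : rowExponent n μ = rowExponent n ν) : μ = ν := by
  refine diagram_ext_rowLen fun i => ?_
  by_cases hi : i < n
  · exact DFunLike.congr_fun h ⟨i, hi⟩
  · rw [rowLen_eq_zero (by omega), rowLen_eq_zero (by omega)]

namespace BoundedSSYT

variable {μ : YoungDiagram} {n : ℕ}

lemma le_entry (T : BoundedSSYT μ n) {i j : ℕ} (hc : (i, j) ∈ μ) : i ≤ T.1 i j := by
  induction i with
  | zero => exact Nat.zero_le _
  | succ i ih =>
    exact (ih (μ.up_left_mem i.le_succ le_rfl hc)).trans_lt (T.1.col_strict i.lt_succ_self hc)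

lemma content_eq_of_entry_eq (T : BoundedSSYT μ n) (v : Fin n)
    (h : ∀ i j : ℕ, i ≤ v → (i, j) ∈ μ → T.1 i j = i) : T.content v = μ.rowLen v := by
  rw [content_apply, YoungDiagram.rowLen_eq_card]
  congr 1
  ext ⟨i, j⟩
  rw [YoungDiagram.mem_row_iff, Finset.mem_filter, YoungDiagram.mem_cells]
  refine and_congr_right fun hc => ?_
  simp only
  by_cases hi : i ≤ v
  · rw [h i j hi hc]
  · have := T.le_entry hc
    omega

lemma content_eq_or_lt (T : BoundedSSYT μ n) :
    (∀ i j, (i, j) ∈ μ → T.1 i j = i) ∨ toLex T.content < toLex (rowExponent n μ) := by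
  classical
  by_cases hall : ∀ i j, (i, j) ∈ μ → T.1 i j = i
  · exact Or.inl hall
  right
  have hex : ∃ i, ∃ j, (i, j) ∈ μ ∧ T.1 i j ≠ i := by
    push Not at hall
    exact hall
  obtain ⟨j, hc, hne⟩ := Nat.find_spec hex
  have hmin : ∀ i j, i < Nat.find hex → (i, j) ∈ μ → T.1 i j = i := fun i j hi hc => by
    by_contra hne
    exact Nat.find_min hex hi ⟨j, hc, hne⟩
  generalize Nat.find hex = r at hc hne hmin
  have hr : r < n := (T.le_entry hc).trans_lt (T.2 _ _ hc)
  rw [Finsupp.Lex.lt_iff]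
  refine ⟨⟨r, hr⟩, fun v hv => ?_, ?_⟩
  · exact T.content_eq_of_entry_eq v fun i j hi hc => hmin i j (lt_of_le_of_lt hi hv) hc
  · change T.content ⟨r, hr⟩ < rowExponent n μ ⟨r, hr⟩
    rw [content_apply, rowExponent_apply, YoungDiagram.rowLen_eq_card]
    refine Finset.card_lt_card ?_
    rw [Finset.ssubset_iff_of_subset]
    · exact ⟨(r, j), YoungDiagram.mk_mem_row_iff.2 hc, by simp [hne]⟩
    · rintro ⟨i, j'⟩ h
      rw [Finset.mem_filter, YoungDiagram.mem_cells] at h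
      obtain ⟨h1, h2⟩ := h
      simp only at h2
      have h3 := T.le_entry h1
      rw [YoungDiagram.mem_row_iff]
      refine ⟨h1, ?_⟩
      by_contra hir
      have hlt : i < r := by
        simp only at hir
        omega
      have := hmin i j' hlt h1
      omega

lemma eq_of_content_eq {T T' : BoundedSSYT μ n} (h : T.content = rowExponent n μ)
    (h' : T'.content = rowExponent n μ) : T = T' := by
  have key : ∀ S : BoundedSSYT μ n, S.content = rowExponent n μ →
      ∀ i j, (i, j) ∈ μ → S.1 i j = i := fun S hS =>
    S.content_eq_or_lt.resolve_right (by rw [hS]; exact lt_irrefl _)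
  apply Subtype.ext
  ext i j
  by_cases hc : (i, j) ∈ μ
  · rw [key T h i j hc, key T' h' i j hc]
  · rw [T.1.zeros hc, T'.1.zeros hc]

lemma exists_content_eq (hμ : μ.colLen 0 ≤ n) :
    ∃ T : BoundedSSYT μ n, T.content = rowExponent n μ := by
  have hentry : ∀ i j, (i, j) ∈ μ → SemistandardYoungTableau.highestWeight μ i j = i :=
    fun i j hc => by rw [SemistandardYoungTableau.highestWeight_apply, if_pos hc]
  refine ⟨⟨SemistandardYoungTableau.highestWeight μ, fun i j hc => ?_⟩, ?_⟩
  · rw [hentry i j hc]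
    have := YoungDiagram.mem_iff_lt_colLen.1 (μ.up_left_mem le_rfl (Nat.zero_le j) hc)
    omega
  · ext v
    exact content_eq_of_entry_eq _ v fun i j _ hc => hentry i j hc

end BoundedSSYT

lemma coeff_rowExponent_schurPoly {n : ℕ} {μ : YoungDiagram} (hμ : μ.colLen 0 ≤ n) :
    coeff (rowExponent n μ) (schurPoly n μ) = 1 := by
  classical
  obtain ⟨T, hT⟩ := BoundedSSYT.exists_content_eq hμ
  rw [coeff_schurPoly, Finset.card_eq_one.2 ⟨T, ?_⟩, Nat.cast_one]
  ext T'
  rw [Finset.mem_filter, Finset.mem_singleton]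
  exact ⟨fun h => BoundedSSYT.eq_of_content_eq h.2 hT, fun h => ⟨Finset.mem_univ _, h ▸ hT⟩⟩

lemma le_rowExponent_of_coeff_ne_zero {n : ℕ} {μ : YoungDiagram} {e : Fin n →₀ ℕ}
    (h : coeff e (schurPoly n μ) ≠ 0) : toLex e ≤ toLex (rowExponent n μ) := by
  classical
  rw [coeff_schurPoly, Nat.cast_ne_zero, Finset.card_ne_zero] at h
  obtain ⟨T, hT⟩ := h
  obtain rfl := (Finset.mem_filter.1 hT).2
  rcases T.content_eq_or_lt with h | h
  · refine le_of_eq (congrArg toLex ?_)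
    ext v
    exact T.content_eq_of_entry_eq v fun i j _ hc => h i j hc
  · exact h.le

theorem IsSchurExpansion.unique {n : ℕ} {f : MvPolynomial (Fin n) ℤ} {a b : YoungDiagram →₀ ℤ}
    (ha : IsSchurExpansion n f a) (hb : IsSchurExpansion n f b) : a = b := by
  classical
  by_contra hne
  have h0 : (a - b).sum (fun μ z => z • schurPoly n μ) = 0 := by
    rw [Finsupp.sum_sub_index fun μ z w => sub_smul z w _, ← ha.2, ← hb.2, sub_self]
  have hcol : ∀ μ ∈ (a - b).support, μ.colLen 0 ≤ n := fun μ hμ => by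
    rcases Finset.mem_union.1 (Finsupp.support_sub hμ) with h | h
    · exact ha.1 μ h
    · exact hb.1 μ h
  obtain ⟨μ, hμ, hmax⟩ := (a - b).support.exists_max_image (fun μ => toLex (rowExponent n μ))
    (Finsupp.support_nonempty_iff.2 (sub_ne_zero.2 hne))
  have h1 := congrArg (coeff (rowExponent n μ)) h0
  rw [Finsupp.sum, coeff_sum, Finset.sum_eq_single_of_mem μ hμ, coeff_smul,
    coeff_rowExponent_schurPoly (hcol μ hμ), coeff_zero, smul_eq_mul, mul_one] at h1
  · exact Finsupp.mem_support_iff.1 hμ h1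
  · intro ν hν hνμ
    rw [coeff_smul]
    by_contra hc
    have h2 := le_rowExponent_of_coeff_ne_zero (right_ne_zero_of_smul hc)
    exact hνμ (rowExponent_injOn (hcol ν hν) (hcol μ hμ)
      (toLex.injective (le_antisymm (hmax ν hν) h2)))

lemma exists_rowExponent_eq {n : ℕ} {e : Fin n →₀ ℕ} (he : Antitone e) :
    ∃ μ : YoungDiagram, μ.colLen 0 ≤ n ∧ rowExponent n μ = e := by
  refine ⟨diagramOfRows n (fun i => if h : i < n then e ⟨i, h⟩ else 0) ?_,
    colLen_diagramOfRows_le, ?_⟩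
  · intro i i' h h'
    simp only [h', h.trans_lt h', dif_pos]
    exact he h
  · ext i
    rw [rowExponent_apply, rowLen_diagramOfRows i.2]
    simp

theorem exists_isSchurExpansion {n : ℕ} {f : MvPolynomial (Fin n) ℤ} (hf : f.IsSymmetric) :
    ∃ a : YoungDiagram →₀ ℤ, IsSchurExpansion n f a := by
  classical
  induction he : AddMonoidAlgebra.supDegree toLex f using WellFoundedLT.induction
    generalizing f with | _ t ih
  subst he
  by_cases h0 : f = 0
  · exact ⟨0, by simp, by simp [h0]⟩
  obtain ⟨μ, hμ, hexp⟩ := exists_rowExponent_eq hf.antitone_supDegree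
  set e := ofLex (AddMonoidAlgebra.supDegree toLex f) with hedef
  have hle : ∀ (g : MvPolynomial (Fin n) ℤ) s, coeff s g ≠ 0 →
      toLex s ≤ AddMonoidAlgebra.supDegree toLex g := fun g s hs =>
    Finset.le_sup (f := toLex) (mem_support_iff.2 hs)
  have hsym : (f - coeff e f • schurPoly n μ).IsSymmetric :=
    hf.sub ((schurPoly_isSymmetric n μ).smul _)
  have hexpand : ∀ a, IsSchurExpansion n (f - coeff e f • schurPoly n μ) a →
      ∃ a, IsSchurExpansion n f a := by
    rintro a ⟨ha1, ha2⟩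
    refine ⟨a + Finsupp.single μ (coeff e f), fun ν hν => ?_, ?_⟩
    · rcases Finset.mem_union.1 (Finsupp.support_add hν) with h | h
      · exact ha1 ν h
      · obtain rfl := Finset.mem_singleton.1 (Finsupp.support_single_subset h)
        exact hμ
    · rw [Finsupp.sum_add_index' (h := fun μ z => z • schurPoly n μ) (fun _ => zero_smul _ _)
        fun _ _ _ => add_smul _ _ _, ← ha2,
        Finsupp.sum_single_index (h := fun μ z => z • schurPoly n μ) (zero_smul _ _), sub_add_cancel]
  by_cases h1 : f - coeff e f • schurPoly n μ = 0
  · exact hexpand 0 ⟨by simp, by rw [h1, Finsupp.sum_zero_index]⟩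
  suffices hlt : AddMonoidAlgebra.supDegree toLex (f - coeff e f • schurPoly n μ) <
      AddMonoidAlgebra.supDegree toLex f by
    obtain ⟨a, ha⟩ := ih _ hlt hsym rfl
    exact hexpand a ha
  set g := f - coeff e f • schurPoly n μ with hg
  have hgne : coeff (ofLex (AddMonoidAlgebra.supDegree toLex g)) g ≠ 0 := by
    rw [← leadingCoeff_toLex, Ne, AddMonoidAlgebra.leadingCoeff_eq_zero toLex.injective]
    exact h1
  refine lt_of_le_of_ne ?_ fun heq => ?_
  · by_cases hc : coeff (ofLex (AddMonoidAlgebra.supDegree toLex g)) f = 0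
    · rw [hg, coeff_sub, hc, zero_sub, neg_ne_zero, coeff_smul] at hgne
      have := le_rowExponent_of_coeff_ne_zero (right_ne_zero_of_smul hgne)
      rw [hexp] at this
      exact this
    · exact hle f _ hc
  · rw [heq, ← hedef, hg, coeff_sub, coeff_smul, ← hexp, coeff_rowExponent_schurPoly hμ,
      smul_eq_mul, mul_one, sub_self] at hgne
    exact hgne rfl


lemma schurPoly_isHomogeneous (n : ℕ) (μ : YoungDiagram) :
    (schurPoly n μ).IsHomogeneous μ.card := by
  refine IsHomogeneous.sum _ _ _ fun T _ => ?_
  have h := IsHomogeneous.prod μ.cells.attach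
    (fun c => (X ⟨T.1 c.1.1 c.1.2, T.2 _ _ c.2⟩ : MvPolynomial (Fin n) ℤ)) (fun _ => 1)
    fun c _ => isHomogeneous_X _ _
  rwa [Finset.sum_const, Finset.card_attach, smul_eq_mul, mul_one] at h

lemma schurBar_isHomogeneous (n : ℕ) (μ : YoungDiagram) :
    (schurBar n μ).IsHomogeneous μ.card := by
  have h := (schurPoly_isHomogeneous n μ).aeval
    (fun i : Fin n => (∑ j : Fin n, X j) - X i : Fin n → MvPolynomial (Fin n) ℤ) (n := 1)
    fun i => (IsHomogeneous.sum _ _ _ fun j _ => isHomogeneous_X _ _).sub (isHomogeneous_X _ _)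
  rwa [one_mul] at h

lemma IsSchurExpansion.eq_sum_filter {n m : ℕ} {f : MvPolynomial (Fin n) ℤ}
    {a : YoungDiagram →₀ ℤ} (ha : IsSchurExpansion n f a) (hf : f.IsHomogeneous m) :
    f = ∑ μ ∈ a.support with μ.card = m, a μ • schurPoly n μ := by
  conv_lhs => rw [← homogeneousComponent_eq_self hf, ha.2, Finsupp.sum, map_sum]
  rw [Finset.sum_filter]
  refine Finset.sum_congr rfl fun μ _ => ?_
  rw [map_smul, homogeneousComponent_of_mem (schurPoly_isHomogeneous n μ)]
  simp only [eq_comm (a := m), smul_ite, smul_zero]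

lemma mem_column {m i j : ℕ} : (i, j) ∈ column m ↔ i < m ∧ j = 0 := by
  rw [column, YoungDiagram.mem_ofRowLens]
  simp

lemma rowLen_add_colLen_le (μ : YoungDiagram) :
    μ.rowLen 0 + μ.colLen 0 ≤ μ.card + 1 := by
  have hsub : μ.row 0 ∪ μ.col 0 ⊆ μ.cells :=
    Finset.union_subset (Finset.filter_subset _ _) (Finset.filter_subset _ _)
  have hinter : μ.row 0 ∩ μ.col 0 ⊆ {(0, 0)} := by
    rintro ⟨i, j⟩ hc
    rw [Finset.mem_inter, YoungDiagram.mem_row_iff, YoungDiagram.mem_col_iff] at hc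
    rw [Finset.mem_singleton]
    exact Prod.ext hc.1.2 hc.2.2
  have h1 := Finset.card_union_add_card_inter (μ.row 0) (μ.col 0)
  have h2 := Finset.card_le_card hsub
  have h3 := Finset.card_le_card hinter
  rw [← YoungDiagram.rowLen_eq_card, ← YoungDiagram.colLen_eq_card] at h1
  rw [Finset.card_singleton] at h3
  change _ ≤ μ.card at h2
  omega

lemma eq_column_card {μ : YoungDiagram} (h : μ.rowLen 0 ≤ 1) : μ = column μ.card := by
  have hj : ∀ i j, (i, j) ∈ μ → j = 0 := fun i j hc => by
    have := YoungDiagram.mem_iff_lt_rowLen.1 (μ.up_left_mem (Nat.zero_le i) le_rfl hc)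
    omega
  have hcard : μ.card = μ.colLen 0 := by
    rw [YoungDiagram.colLen_eq_card, YoungDiagram.col, Finset.filter_true_of_mem]
    exact fun c hc => hj c.1 c.2 hc
  ext ⟨i, j⟩
  rw [YoungDiagram.mem_cells, YoungDiagram.mem_cells, mem_column, hcard,
    ← YoungDiagram.mem_iff_lt_colLen]
  constructor
  · intro hc
    obtain rfl := hj i j hc
    exact ⟨hc, rfl⟩
  · rintro ⟨hc, rfl⟩
    exact hc

lemma rowLen_column {m i : ℕ} (h : i < m) : (column m).rowLen i = 1 := by
  refine le_antisymm ?_ (YoungDiagram.mem_iff_lt_rowLen.1 (mem_column.2 ⟨h, rfl⟩))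
  by_contra hlt
  have := YoungDiagram.mem_iff_lt_rowLen.2 (not_le.1 hlt)
  exact one_ne_zero (mem_column.1 this).2

lemma colLen_column (m : ℕ) : (column m).colLen 0 = m := by
  refine eq_of_forall_lt_iff fun i => ?_
  rw [← YoungDiagram.mem_iff_lt_colLen, mem_column]
  simp

lemma prod_sub_pow_mul {K : Type*} [CommRing K] [IsDomain K] {ζ : K} {n : ℕ}
    (h : IsPrimitiveRoot ζ (n + 1)) (a b : K) :
    (a - b) * ∏ i : Fin n, (a - ζ ^ ((i : ℕ) + 1) * b) = a ^ (n + 1) - b ^ (n + 1) := by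
  classical
  have himage : Polynomial.nthRootsFinset (n + 1) (1 : K) =
      (Finset.range (n + 1)).image fun i => ζ ^ i := by
    symm
    refine Finset.eq_of_subset_of_card_le ?_ ?_
    · intro x hx
      obtain ⟨i, _, rfl⟩ := Finset.mem_image.1 hx
      rw [Polynomial.mem_nthRootsFinset n.succ_pos, ← pow_mul, mul_comm, pow_mul, h.pow_eq_one,
        one_pow]
    · rw [h.card_nthRootsFinset, Finset.card_image_of_injOn, Finset.card_range]
      intro i hi j hj hij
      exact h.pow_inj (Finset.mem_range.1 hi) (Finset.mem_range.1 hj) hij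
  rw [h.pow_sub_pow_eq_prod_sub_mul a b n.succ_pos, himage, Finset.prod_image,
    Finset.prod_range_succ', Finset.prod_range, pow_zero, one_mul, mul_comm]
  intro i hi j hj hij
  exact h.pow_inj (Finset.mem_range.1 hi) (Finset.mem_range.1 hj) hij

section

variable {n : ℕ} {ζ : ℂ}

lemma prod_C_sub_pow_mul (h : IsPrimitiveRoot ζ (n + 1)) (a b : PowerSeries ℂ) :
    (a - b) * ∏ i : Fin n, (a - PowerSeries.C (ζ ^ ((i : ℕ) + 1)) * b) =
      a ^ (n + 1) - b ^ (n + 1) := by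
  have h' : IsPrimitiveRoot (PowerSeries.C ζ) (n + 1) :=
    h.map_of_injective PowerSeries.C_injective
  rw [← prod_sub_pow_mul h' a b]
  simp only [map_pow]

lemma coeff_X_pow_mul_congr {R : Type*} [CommRing R] {P Q S : PowerSeries R} {N k : ℕ} (j : ℕ)
    (h : P = Q + PowerSeries.X ^ (N + 1) * S) (hk : k ≤ N) :
    PowerSeries.coeff k (PowerSeries.X ^ j * P) = PowerSeries.coeff k (PowerSeries.X ^ j * Q) := by
  rw [h, mul_add, map_add, mul_left_comm, PowerSeries.coeff_X_pow_mul' _ (N + 1),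
    if_neg (by omega), add_zero]

lemma coeff_completeSeries_neg_root (h : IsPrimitiveRoot ζ (n + 1)) {k : ℕ} (j : ℕ) (hk : k ≤ n) :
    PowerSeries.coeff k (PowerSeries.X ^ j *
      completeSeries fun i : Fin n => -ζ ^ ((i : ℕ) + 1)) =
      PowerSeries.coeff k (PowerSeries.X ^ j * (1 + PowerSeries.X)) := by
  set P := completeSeries fun i : Fin n => -ζ ^ ((i : ℕ) + 1) with hP
  refine coeff_X_pow_mul_congr (S := P * (-1) ^ (n + 1)) j ?_ hk
  have h1 := completeSeries_mul_prod fun i : Fin n => -ζ ^ ((i : ℕ) + 1)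
  have h2 := prod_C_sub_pow_mul h 1 (-PowerSeries.X)
  have h3 : ∏ i : Fin n, (1 - PowerSeries.C (-ζ ^ ((i : ℕ) + 1)) * PowerSeries.X) =
      ∏ i : Fin n, (1 - PowerSeries.C (ζ ^ ((i : ℕ) + 1)) * (-PowerSeries.X)) := by
    refine Finset.prod_congr rfl fun i _ => ?_
    rw [map_neg]
    ring
  rw [h3, ← hP] at h1
  rw [neg_pow (PowerSeries.X) (n + 1)] at h2
  linear_combination (-P) * h2 + (1 + PowerSeries.X) * h1

lemma coeff_completeSeries_one_add_root (h : IsPrimitiveRoot ζ (n + 1)) {k : ℕ} (j : ℕ)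
    (hk : k ≤ n) :
    PowerSeries.coeff k (PowerSeries.X ^ j *
      completeSeries fun i : Fin n => 1 + ζ ^ ((i : ℕ) + 1)) =
      PowerSeries.coeff k (PowerSeries.X ^ j *
        ((1 - 2 * PowerSeries.X) * PowerSeries.mk 1 ^ (n + 1))) := by
  set P := completeSeries fun i : Fin n => 1 + ζ ^ ((i : ℕ) + 1) with hP
  refine coeff_X_pow_mul_congr (S := P * PowerSeries.mk 1 ^ (n + 1)) j ?_ hk
  have h1 := completeSeries_mul_prod fun i : Fin n => 1 + ζ ^ ((i : ℕ) + 1)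
  have h2 := prod_C_sub_pow_mul h (1 - PowerSeries.X) PowerSeries.X
  have h3 : ∏ i : Fin n, (1 - PowerSeries.C (1 + ζ ^ ((i : ℕ) + 1)) * PowerSeries.X) =
      ∏ i : Fin n, (1 - PowerSeries.X - PowerSeries.C (ζ ^ ((i : ℕ) + 1)) * PowerSeries.X) := by
    refine Finset.prod_congr rfl fun i _ => ?_
    rw [map_add, map_one]
    ring
  have h4 : (PowerSeries.mk 1 : PowerSeries ℂ) ^ (n + 1) * (1 - PowerSeries.X) ^ (n + 1) = 1 := by
    rw [← mul_pow, PowerSeries.mk_one_mul_one_sub_eq_one, one_pow]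
  rw [h3, ← hP] at h1
  linear_combination (-P) * h4 + (-P * PowerSeries.mk 1 ^ (n + 1)) * h2 +
    (1 - 2 * PowerSeries.X) * PowerSeries.mk 1 ^ (n + 1) * h1

lemma coeff_X_pow_mul_one_add_X {R : Type*} [CommRing R] (k j : ℕ) :
    PowerSeries.coeff k (PowerSeries.X ^ j * (1 + PowerSeries.X) : PowerSeries R) =
      if k = j ∨ k = j + 1 then 1 else 0 := by
  rw [mul_add, mul_one, ← pow_succ, map_add, PowerSeries.coeff_X_pow, PowerSeries.coeff_X_pow]
  by_cases h1 : k = j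
  · simp [h1]
  · simp [h1]

lemma endColumn_lt {l n : ℕ} {μ : YoungDiagram} (h : μ.rowLen 0 + l ≤ n + 1) (k : Fin l) :
    endColumn l μ k ≤ n := by
  have h1 := μ.rowLen_anti 0 k.rev (Nat.zero_le _)
  have h2 := k.2
  rw [endColumn]
  omega

open Classical in
lemma aeval_neg_root_schurPoly (h : IsPrimitiveRoot ζ (n + 1)) {μ : YoungDiagram}
    (hμ : μ.card ≤ n) :
    aeval (fun i : Fin n => -ζ ^ ((i : ℕ) + 1)) (schurPoly n μ) =
      if μ = column μ.card then (1 : ℂ) else 0 := by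
  rw [aeval_schurPoly _ le_rfl]
  by_cases hrow : μ.rowLen 0 ≤ 1
  · have hcol := eq_column_card hrow
    rw [if_pos hcol]
    generalize μ.card = m at hμ hcol
    subst hcol
    have hentry : ∀ k j : Fin ((column m).colLen 0),
        PowerSeries.coeff (endColumn ((column m).colLen 0) (column m) k)
          (PowerSeries.X ^ (j : ℕ) * completeSeries fun i : Fin n => -ζ ^ ((i : ℕ) + 1)) =
        if (k : ℕ) + 1 = j ∨ (k : ℕ) = j then 1 else 0 := by
      intro k j
      have hk := k.2
      have hrev := Fin.val_rev k
      have hc := colLen_column m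
      have hend : endColumn ((column m).colLen 0) (column m) k = k + 1 := by
        rw [endColumn, rowLen_column (by omega), add_comm]
      rw [hend, coeff_completeSeries_neg_root h _ (by omega), coeff_X_pow_mul_one_add_X]
      simp only [Nat.add_right_cancel_iff]
    rw [Matrix.det_of_isUpperTriangular]
    · refine Finset.prod_eq_one fun k _ => ?_
      rw [Matrix.of_apply, hentry, if_pos (Or.inr rfl)]
    · intro k j hlt
      have hlt' : (j : ℕ) < k := hlt
      rw [Matrix.of_apply, hentry, if_neg (by omega)]
  · have hne : μ ≠ column μ.card := fun heq => hrow (by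
      by_cases h0 : 0 < μ.card
      · rw [heq, rowLen_column h0]
      · by_contra hlt
        have := YoungDiagram.mem_iff_lt_rowLen.2 (not_le.1 hlt)
        exact h0 (Finset.card_pos.2 ⟨_, this⟩))
    rw [if_neg hne]
    have hpos : 0 < μ.colLen 0 :=
      YoungDiagram.mem_iff_lt_colLen.1 (YoungDiagram.mem_iff_lt_rowLen.2 (by omega))
    have hhook := rowLen_add_colLen_le μ
    refine Matrix.det_eq_zero_of_row_eq_zero (Fin.rev ⟨0, hpos⟩) fun j => ?_
    have hj := j.2
    rw [Matrix.of_apply, coeff_completeSeries_neg_root h _ (endColumn_lt (by omega) _),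
      coeff_X_pow_mul_one_add_X, if_neg]
    rw [endColumn, Fin.rev_rev, Fin.val_rev]
    simp only
    omega

lemma aeval_neg_root_schurBar (h : IsPrimitiveRoot ζ (n + 1)) (μ : YoungDiagram) :
    aeval (fun i : Fin n => -ζ ^ ((i : ℕ) + 1)) (schurBar n μ) =
      aeval (fun i : Fin n => 1 + ζ ^ ((i : ℕ) + 1)) (schurPoly n μ) := by
  rw [schurBar, comp_aeval_apply _ (aeval fun i : Fin n => -ζ ^ ((i : ℕ) + 1))]
  congr 2
  ext1 i
  have hn : 1 < n + 1 := Nat.succ_lt_succ (i.1.zero_le.trans_lt i.2)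
  have hsum := h.geom_sum_eq_zero hn
  rw [Finset.sum_range_succ', Finset.sum_range, pow_zero] at hsum
  simp only [map_sub, map_sum, aeval_X, Finset.sum_neg_distrib]
  linear_combination -hsum

theorem IsSchurExpansion.apply_column {μ : YoungDiagram} {a : YoungDiagram →₀ ℤ}
    (h : IsPrimitiveRoot ζ (n + 1)) (hμ : μ.card ≤ n) (ha : IsSchurExpansion n (schurBar n μ) a) :
    (a (column μ.card) : ℂ) =
      aeval (fun i : Fin n => 1 + ζ ^ ((i : ℕ) + 1)) (schurPoly n μ) := by
  classical
  rw [← aeval_neg_root_schurBar h, ha.eq_sum_filter (schurBar_isHomogeneous n μ), map_sum]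
  have hcard : (column μ.card).card = μ.card := by
    rw [card_eq_sum_rowLen (colLen_column _).le,
      Finset.sum_congr rfl fun k _ => rowLen_column (Fin.rev k).2]
    simp
  have hterm : ∀ ν ∈ a.support.filter (fun ν => ν.card = μ.card),
      aeval (fun i : Fin n => -ζ ^ ((i : ℕ) + 1)) (a ν • schurPoly n ν) =
        if ν = column μ.card then (a ν : ℂ) else 0 := by
    intro ν hν
    have hνμ := (Finset.mem_filter.1 hν).2
    rw [map_zsmul, aeval_neg_root_schurPoly h (hνμ.trans_le hμ), hνμ, zsmul_eq_mul, mul_ite,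
      mul_one, mul_zero]
  rw [Finset.sum_congr rfl hterm, Finset.sum_ite_eq']
  split_ifs with hmem
  · rfl
  · have h0 : a (column μ.card) = 0 := by
      by_contra hne
      exact hmem (Finset.mem_filter.2 ⟨Finsupp.mem_support_iff.2 hne, hcard⟩)
    rw [h0, Int.cast_zero]

end


section

variable {R : Type*} [CommRing R]

lemma coeff_mul_mk_one (P : PowerSeries R) (x : ℕ) :
    PowerSeries.coeff x (P * PowerSeries.mk 1) =
      ∑ y ∈ Finset.range (x + 1), PowerSeries.coeff y P := by
  have h := coeff_mul_mk_pow P 1 x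
  simp only [one_pow, one_mul] at h
  exact h

lemma coeff_X_pow_mul_mk_one_pow_eq {m j : ℕ} (h : j ≤ m) :
    PowerSeries.coeff m (PowerSeries.X ^ j * PowerSeries.mk 1 ^ (m + 1) : PowerSeries R) =
      PowerSeries.coeff m (PowerSeries.mk 1 ^ (m + 1 - j) : PowerSeries R) := by
  rw [PowerSeries.coeff_X_pow_mul', if_pos h, Nat.succ_sub h, Nat.succ_eq_add_one,
    PowerSeries.mk_one_pow_eq_mk_choose_add, PowerSeries.mk_one_pow_eq_mk_choose_add,
    PowerSeries.coeff_mk, PowerSeries.coeff_mk, add_comm (m - j) m, Nat.choose_symm_add]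

lemma coeff_X_pow_mul_mk_one_pow_add_two (m j : ℕ) :
    PowerSeries.coeff (m + 1)
      (PowerSeries.X ^ (j + 2) * PowerSeries.mk 1 ^ (m + 2) : PowerSeries R) =
      PowerSeries.coeff (m + 1) (PowerSeries.mk 1 ^ (m - j) : PowerSeries R) := by
  by_cases h : j + 2 ≤ m + 1
  · rw [coeff_X_pow_mul_mk_one_pow_eq h, show m + 1 + 1 - (j + 2) = m - j by omega]
  · rw [PowerSeries.coeff_X_pow_mul', if_neg h, Nat.sub_eq_zero_of_le (by omega), pow_zero,
      PowerSeries.coeff_one, if_neg m.succ_ne_zero]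

/-- The path counts when the special columns form the diagonal, below and above that diagonal. -/
lemma pathSum_diagonal (m j x : ℕ) :
    (x ≤ m + 1 → pathSum (1 : ℕ → R) (fun v => (v : ℤ) + 1) m x j =
      PowerSeries.coeff x (PowerSeries.X ^ j * PowerSeries.mk 1 ^ m -
        PowerSeries.X ^ (j + 2) * PowerSeries.mk 1 ^ (m + 2))) ∧
    (m < x → pathSum (1 : ℕ → R) (fun v => (v : ℤ) + 1) m x j =
      PowerSeries.coeff x (PowerSeries.X ^ j * PowerSeries.mk 1 ^ m -
        PowerSeries.mk 1 ^ (m - j))) := by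
  induction m generalizing x with
  | zero =>
    simp only [pathSum, pow_zero, mul_one, map_sub, PowerSeries.coeff_X_pow, Nat.zero_sub,
      PowerSeries.coeff_one]
    refine ⟨fun h => ?_, fun h => ?_⟩
    · rw [PowerSeries.coeff_X_pow_mul', if_neg (show ¬ j + 2 ≤ x by omega), sub_zero]
    · rw [if_neg (show ¬ x = 0 by omega), sub_zero]
  | succ m ih =>
    have hstep : pathSum (1 : ℕ → R) (fun v => (v : ℤ) + 1) (m + 1) x j =
        ∑ y ∈ Finset.range (x + 1) with (m + 1 < x → m + 1 ≤ y),
          pathSum (1 : ℕ → R) (fun v => (v : ℤ) + 1) m y j := by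
      simp only [pathSum, Pi.one_apply, one_pow, one_mul]
      refine Finset.sum_congr (Finset.filter_congr fun y _ => ?_) fun _ _ => rfl
      norm_cast
    have hupper : m + 1 < x → pathSum (1 : ℕ → R) (fun v => (v : ℤ) + 1) (m + 1) x j =
        PowerSeries.coeff x (PowerSeries.X ^ j * PowerSeries.mk 1 ^ (m + 1) -
          PowerSeries.mk 1 ^ (m + 1 - j)) := by
      intro h
      have hIco : (Finset.range (x + 1)).filter (fun y => m + 1 < x → m + 1 ≤ y) =
          Finset.Ico (m + 1) (x + 1) := by
        ext y
        simp only [Finset.mem_filter, Finset.mem_range, Finset.mem_Ico]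
        omega
      rw [hstep, hIco, Finset.sum_congr rfl fun y hy =>
        (ih y).2 (Nat.lt_of_succ_le (Finset.mem_Ico.1 hy).1)]
      by_cases hj : j ≤ m
      · rw [Finset.sum_Ico_eq_sub _ (by omega), ← coeff_mul_mk_one, ← coeff_mul_mk_one, sub_mul,
          mul_assoc, ← pow_succ, ← pow_succ, show m - j + 1 = m + 1 - j by omega,
          map_sub (PowerSeries.coeff m), coeff_X_pow_mul_mk_one_pow_eq hj, sub_self, sub_zero]
      · have h1 : ∀ y ∈ Finset.Ico (m + 1) (x + 1), PowerSeries.coeff y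
            (PowerSeries.X ^ j * PowerSeries.mk 1 ^ m - PowerSeries.mk 1 ^ (m - j)) =
            PowerSeries.coeff y (PowerSeries.X ^ j * PowerSeries.mk 1 ^ m : PowerSeries R) := by
          intro y hy
          have := (Finset.mem_Ico.1 hy).1
          rw [Nat.sub_eq_zero_of_le (by omega), pow_zero, map_sub, PowerSeries.coeff_one,
            if_neg (by omega), sub_zero]
        rw [Finset.sum_congr rfl h1, Finset.sum_Ico_eq_sub _ (by omega), ← coeff_mul_mk_one,
          ← coeff_mul_mk_one, mul_assoc, ← pow_succ, map_sub,
          PowerSeries.coeff_X_pow_mul' _ _ m, if_neg hj,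
          Nat.sub_eq_zero_of_le (show m + 1 ≤ j by omega), pow_zero, PowerSeries.coeff_one,
          if_neg (show ¬ x = 0 by omega)]
    refine ⟨fun h => ?_, hupper⟩
    rcases h.lt_or_eq with h | rfl
    · rw [hstep, Finset.filter_true_of_mem fun y _ hlt => by omega,
        Finset.sum_congr rfl fun y hy => (ih y).1 (by
          have := Finset.mem_range.1 hy
          omega), ← coeff_mul_mk_one, sub_mul, mul_assoc, mul_assoc, ← pow_succ, ← pow_succ]
    · rw [hupper (by omega), map_sub, map_sub, coeff_X_pow_mul_mk_one_pow_add_two]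

lemma pathSum_diagonal_eq_coeff {m j x : ℕ} (h : x ≤ m + 1) :
    pathSum (1 : ℕ → R) (fun v => (v : ℤ) + 1) m x j =
      PowerSeries.coeff x (PowerSeries.X ^ j *
        ((1 - 2 * PowerSeries.X) * PowerSeries.mk 1 ^ (m + 2))) := by
  rw [(pathSum_diagonal m j x).1 h]
  congr 1
  have h1 := PowerSeries.mk_one_mul_one_sub_eq_one R
  have h2 : (PowerSeries.mk 1 : PowerSeries R) ^ 2 * (1 - PowerSeries.X) ^ 2 = 1 := by
    rw [← mul_pow, h1, one_pow]
  linear_combination (-PowerSeries.X ^ j * PowerSeries.mk 1 ^ m) * h2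

end

/-- Shifting the entries by two turns the fillings with entries `2, …, n` into fillings
with letters `0, …, n - 2`. -/
def ColumnFilling.toTwisted {n p : ℕ} {μ : YoungDiagram} (T : ColumnFilling n p μ) :
    TwistedTableau (fun v => (v : ℤ) + 1 - p) (n - 1) μ where
  entry i j := T.entry i j - 2
  lt i j hc := by
    have := Finset.mem_Icc.1 (T.mem_Icc i j hc)
    omega
  row i j hc := by
    have hc' : (i, j) ∈ μ := μ.up_left_mem le_rfl j.le_succ hc
    have h1 := Finset.mem_Icc.1 (T.mem_Icc i j hc')
    have h2 := Finset.mem_Icc.1 (T.mem_Icc i (j + 1) hc)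
    have h3 := T.row i j hc' hc
    omega
  col i j hc := by
    have hc' : (i, j) ∈ μ := μ.up_left_mem i.le_succ le_rfl hc
    have h1 := Finset.mem_Icc.1 (T.mem_Icc i j hc')
    have h2 := Finset.mem_Icc.1 (T.mem_Icc (i + 1) j hc)
    have h3 := T.col i j hc' hc
    omega
  zeros i j hc := by rw [T.zeros i j hc]

lemma ColumnFilling.toTwisted_bijective (n p : ℕ) (μ : YoungDiagram) :
    Function.Bijective (ColumnFilling.toTwisted : ColumnFilling n p μ → _) := by
  constructor
  · intro T T' h
    ext i j
    by_cases hc : (i, j) ∈ μ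
    · have h1 := Finset.mem_Icc.1 (T.mem_Icc i j hc)
      have h2 := Finset.mem_Icc.1 (T'.mem_Icc i j hc)
      have h3 : T.entry i j - 2 = T'.entry i j - 2 := congrArg (fun S => S.entry i j) h
      omega
    · rw [T.zeros i j hc, T'.zeros i j hc]
  · intro T
    refine ⟨⟨fun i j => if (i, j) ∈ μ then T.entry i j + 2 else 0, fun i j hc => ?_,
      fun i j hc hc' => ?_, fun i j hc hc' => ?_, fun i j hc => if_neg hc⟩, ?_⟩
    · have := T.lt i j hc
      rw [if_pos hc, Finset.mem_Icc]
      omega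
    · have := T.row i j hc'
      rw [if_pos hc, if_pos hc']
      omega
    · have := T.col i j hc'
      rw [if_pos hc, if_pos hc']
      omega
    · ext i j
      by_cases hc : (i, j) ∈ μ
      · simp [ColumnFilling.toTwisted, hc]
      · simp [ColumnFilling.toTwisted, hc, T.zeros i j hc]

theorem card_columnFilling_eq_det {R : Type*} [CommRing R] {n p : ℕ} {μ : YoungDiagram}
    (hp : μ.colLen 0 ≤ p) (hpn : μ.rowLen 0 + p ≤ n) :
    (Nat.card (ColumnFilling n p μ) : R) = Matrix.det (Matrix.of fun k j : Fin p =>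
      PowerSeries.coeff (endColumn p μ k) (PowerSeries.X ^ (j : ℕ) *
        ((1 - 2 * PowerSeries.X) * PowerSeries.mk 1 ^ (n + 1)))) := by
  have h := TwistedTableau.sum_weight_eq_det (1 : ℕ → R) (fun v => (v : ℤ) + 1 - p) (n - 1) hp
  simp only [TwistedTableau.weight, Pi.one_apply, Finset.prod_const_one, Finset.sum_const,
    Finset.card_univ, nsmul_eq_mul, mul_one, sub_add_cancel] at h
  rw [Nat.card_eq_of_bijective _ (ColumnFilling.toTwisted_bijective n p μ),
    Nat.card_eq_fintype_card, h]
  congr 1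
  ext k j
  have hk := k.2
  have hend : endColumn p μ k ≤ n := endColumn_lt (by omega) k
  rw [Matrix.of_apply, Matrix.of_apply, pathSum_diagonal_eq_coeff (by omega),
    show n - 1 + 2 = n + 1 by omega]

end ChernPlethysm

theorem theorem5p1 (n p : ℕ) (μ : YoungDiagram) (hμ : μ.card ≤ n)
    (hp : μ.colLen 0 ≤ p) (hpn : (p : ℤ) ≤ (n : ℤ) - μ.rowLen 0) :
    (∃! a : YoungDiagram →₀ ℤ,
      ChernPlethysm.IsSchurExpansion n (ChernPlethysm.schurBar n μ) a) ∧
    ∀ a : YoungDiagram →₀ ℤ,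
      ChernPlethysm.IsSchurExpansion n (ChernPlethysm.schurBar n μ) a →
        a (ChernPlethysm.column μ.card) = Nat.card (ChernPlethysm.ColumnFilling n p μ) := by
  refine ⟨?_, fun a ha => ?_⟩
  · obtain ⟨a, ha⟩ :=
      ChernPlethysm.exists_isSchurExpansion (ChernPlethysm.schurBar_isSymmetric n μ)
    exact ⟨a, ha, fun b hb => hb.unique ha⟩
  · have hζ := Complex.isPrimitiveRoot_exp (n + 1) n.succ_ne_zero
    have h := ha.apply_column hζ hμ
    rw [ChernPlethysm.aeval_schurPoly _ hp] at h
    have hcast : (a (ChernPlethysm.column μ.card) : ℂ) =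
        (Nat.card (ChernPlethysm.ColumnFilling n p μ) : ℂ) := by
      rw [h, ChernPlethysm.card_columnFilling_eq_det hp (by omega)]
      congr 1
      ext k j
      exact ChernPlethysm.coeff_completeSeries_one_add_root hζ _
        (ChernPlethysm.endColumn_lt (by omega) k)
    exact_mod_cast hcast
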